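/- Let $\mathbb R^2_{++}=\{x\in\mathbb R^2: x_1>0,\ x_2>0\}$ and let $f(x)=-\ln x_1-\ln x_2$ for $x\in\mathbb R^2_{++}$, $f(x)=+\infty$ otherwise, so that $\operatorname{dom} f=\mathbb R^2_{++}$. Let $D$ be the corresponding Itakura–Saito distance on $\mathbb R^2$, $$D(x,y)=\sum_{j=1}^{2}\Big(\ln\frac{y_j}{x_j}+\frac{x_j}{y_j}-1\Big)\ \text{ if } x,y\in\mathbb R^2_{++},\qquad D(x,y)=+\infty\ \text{ otherwise}.$$ Let $a>1$, $c_0=(1,a)$, $c_1=(a,1)$, $c_\lambda=(1-\lambda)c_0+\lambda c_1$ for $\lambda\in\mathbb R$, and let $C=\operatorname{conv}\{c_0,c_1\}$. For $x\in\mathbb R^2$ put $F_C(x)=\sup_{c\in C}D(x,c)$, and let the set of farthest points of $x$ be $Q_C(x)=\{c\in C: D(x,c)=F_C(x)\}$ if $x\in\operatorname{dom} f$ and $Q_C(x)=\varnothing$ otherwise. The Chebyshev center of $C$ is the unique minimizer of $F_C$ over $\mathbb R^2$ (a point of $\operatorname{dom} f$). Set $$g=\frac{a(a+1)}{(a-1)^2}\ln\Big(\frac{(a+1)^2}{4a}\Big),\qquad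 h=\frac{2a}{a+1}.$$ Then $F_C$ has a unique minimizer $z$ over $\mathbb R^2$, it lies in $\operatorname{dom} f$, and $$z=\begin{cases}(h,h),&\text{if } g<h,\\ (g,g),&\text{if } g\ge h,\end{cases}\qquad\text{and}\qquad Q_C(z)=\begin{cases}\{c_0,c_1\},&\text{if } g<h,\\ \{c_0,c_{1/2},c_1\},&\text{if } g\ge h.\end{cases}$$ -/

import Mathlib

noncomputable section

namespace BregmanCenter

/-- The open positive orthant of `ℝ^J`. -/
def posOrthant (J : ℕ) : Set (EuclideanSpace ℝ (Fin J)) :=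
  {x | ∀ j, 0 < x j}

/-- The domain of an extended-real-valued function: the points where it is not `+∞`. -/
def effDom {J : ℕ} (f : EuclideanSpace ℝ (Fin J) → EReal) :
    Set (EuclideanSpace ℝ (Fin J)) :=
  {x | f x < ⊤}

open Classical in
/-- The negative logarithm `f(x) = -∑ ln x_j` on the open positive orthant, `+∞` elsewhere;
the function that induces the Itakura-Saito distance. -/
def negLog (J : ℕ) (x : EuclideanSpace ℝ (Fin J)) : EReal :=
  if x ∈ posOrthant J then ((-∑ j, Real.log (x j) : ℝ) : EReal) else ⊤

open Classical in
/-- The Itakura-Saito distance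
`D(x,y) = ∑ (ln (y_j / x_j) + x_j / y_j - 1)` if `x` and `y` lie in the open positive orthant,
and `+∞` otherwise. -/
def itakuraSaito (J : ℕ) (x y : EuclideanSpace ℝ (Fin J)) : EReal :=
  if x ∈ posOrthant J ∧ y ∈ posOrthant J then
    ((∑ j, (Real.log (y j / x j) + x j / y j - 1) : ℝ) : EReal)
  else ⊤

/-- The right farthest-distance function `x ↦ sup_{c ∈ C} D(x,c)`. -/
def farDist {J : ℕ} (D : EuclideanSpace ℝ (Fin J) → EuclideanSpace ℝ (Fin J) → EReal)
    (C : Set (EuclideanSpace ℝ (Fin J))) (x : EuclideanSpace ℝ (Fin J)) : EReal :=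
  ⨆ c ∈ C, D x c

open Classical in
/-- The right farthest-point map: the points `c ∈ C` with `D(x,c) = sup_{c' ∈ C} D(x,c')`
if `x ∈ dom f`, and the empty set otherwise. -/
def farPoints {J : ℕ} (f : EuclideanSpace ℝ (Fin J) → EReal)
    (D : EuclideanSpace ℝ (Fin J) → EuclideanSpace ℝ (Fin J) → EReal)
    (C : Set (EuclideanSpace ℝ (Fin J))) (x : EuclideanSpace ℝ (Fin J)) :
    Set (EuclideanSpace ℝ (Fin J)) :=
  if x ∈ effDom f then {c ∈ C | D x c = farDist D C x} else ∅

/-- `z` is the Chebyshev center of `C`: it lies in `dom f` and is the unique minimizer over `ℝ^J`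
of the farthest-distance function. -/
def IsChebyshevCenter {J : ℕ} (f : EuclideanSpace ℝ (Fin J) → EReal)
    (D : EuclideanSpace ℝ (Fin J) → EuclideanSpace ℝ (Fin J) → EReal)
    (C : Set (EuclideanSpace ℝ (Fin J))) (z : EuclideanSpace ℝ (Fin J)) : Prop :=
  z ∈ effDom f ∧ (∀ w, farDist D C z ≤ farDist D C w) ∧
    ∀ z', (∀ w, farDist D C z' ≤ farDist D C w) → z' = z

/-- The point `c_t = (1 - t) c_0 + t c_1` with `c_0 = (1, a)` and `c_1 = (a, 1)`. -/
def linePoint (a t : ℝ) : EuclideanSpace ℝ (Fin 2) :=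
  (1 - t) • !₂[1, a] + t • !₂[a, 1]

/-- The segment between `(1, a)` and `(a, 1)`. -/
def segC (a : ℝ) : Set (EuclideanSpace ℝ (Fin 2)) :=
  convexHull ℝ {!₂[1, a], !₂[a, 1]}

/-- `g(a) = a (a + 1) / (a - 1)^2 * ln ((a + 1)^2 / (4 a))`. -/
def gVal (a : ℝ) : ℝ :=
  a * (a + 1) / (a - 1) ^ 2 * Real.log ((a + 1) ^ 2 / (4 * a))

/-- `h(a) = 2 a / (a + 1)`. -/
def hVal (a : ℝ) : ℝ :=
  2 * a / (a + 1)

end BregmanCenter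

end

/-!
On the diagonal the distance to `c = (u, v) ∈ C` depends only on the product `p = u v`, because
`u + v = a + 1` along `C`: it equals `log p + t (a + 1) / p` up to a constant.  The function
`p ↦ log p + k / p` decreases for `p ≤ k` and increases for `p ≥ k`, so on `C`, where `p` runs over
`[a, (a + 1) ^ 2 / 4]`, it is maximal only at the endpoints `c_0`, `c_1` (`p = a`) or at the midpoint
`c_{1/2}` (`p = (a + 1) ^ 2 / 4`).  The two values agree exactly for `t = g`, and the endpoints win
for `t > g` (`isDist_diag_mid_sub`).

Optimality is certified by weights (`isChebyshevCenter_of_weights`): if points `c_i` of `C` are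
farthest from `z` and the weights `w_i` satisfy `∑ w_i = 1` and `∑ w_i / c_i = 1 / z`
coordinatewise, then `∑ w_i D(x, c_i) = F_C(z) + D(x, z)`, hence `F_C(x) ≥ F_C(z) + D(x, z)`, and
`D(x, z)` vanishes only at `x = z`.  If `g < h`, equal weights on the endpoints certify `(h, h)`,
`h` being the harmonic mean of `1` and `a`.  If `h ≤ g`, then `h ≤ g ≤ (a + 1) / 2`, the second
inequality being `log y ≤ y - 1`, so `1 / g` is a convex combination of `1 / h` and
`2 / (a + 1)`, which yields weights on `c_0`, `c_{1/2}`, `c_1` certifying `(g, g)`.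
-/

noncomputable section

namespace BregmanCenter

/-! ### The Itakura-Saito distance and a sufficient condition for centers -/

/-- The real-valued expression of the Itakura-Saito distance; it is the distance only for `x` and
`y` in the open positive orthant. -/
def isDist {J : ℕ} (x y : EuclideanSpace ℝ (Fin J)) : ℝ :=
  ∑ j, (Real.log (y j / x j) + x j / y j - 1)

variable {J : ℕ}

theorem itakuraSaito_eq_isDist {x y : EuclideanSpace ℝ (Fin J)} (hx : x ∈ posOrthant J)
    (hy : y ∈ posOrthant J) : itakuraSaito J x y = (isDist x y : EReal) :=
  if_pos ⟨hx, hy⟩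

theorem itakuraSaito_eq_top {x : EuclideanSpace ℝ (Fin J)} (hx : x ∉ posOrthant J)
    (y : EuclideanSpace ℝ (Fin J)) : itakuraSaito J x y = ⊤ :=
  if_neg fun h => hx h.1

theorem mem_effDom_negLog {x : EuclideanSpace ℝ (Fin J)} (hx : x ∈ posOrthant J) :
    x ∈ effDom (negLog J) := by
  have h : negLog J x = ((-∑ j, Real.log (x j) : ℝ) : EReal) := if_pos hx
  exact h.trans_lt (EReal.coe_lt_top _)

theorem log_div_add_div_sub_one_nonneg {x y : ℝ} (hx : 0 < x) (hy : 0 < y) :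
    0 ≤ Real.log (y / x) + x / y - 1 := by
  have h := Real.log_le_sub_one_of_pos (div_pos hx hy)
  rw [← inv_div x y, Real.log_inv]
  linarith

theorem eq_of_log_div_add_div_sub_one_eq_zero {x y : ℝ} (hx : 0 < x) (hy : 0 < y)
    (h : Real.log (y / x) + x / y - 1 = 0) : x = y := by
  by_contra hne
  have h1 := Real.log_lt_sub_one_of_pos (div_pos hx hy)
    (fun h' => hne ((div_eq_one_iff_eq hy.ne').1 h'))
  rw [← inv_div x y, Real.log_inv] at h
  linarith

theorem isDist_nonneg {x y : EuclideanSpace ℝ (Fin J)} (hx : x ∈ posOrthant J)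
    (hy : y ∈ posOrthant J) : 0 ≤ isDist x y :=
  Finset.sum_nonneg fun j _ => log_div_add_div_sub_one_nonneg (hx j) (hy j)

theorem eq_of_isDist_le_zero {x y : EuclideanSpace ℝ (Fin J)} (hx : x ∈ posOrthant J)
    (hy : y ∈ posOrthant J) (h : isDist x y ≤ 0) : x = y := by
  have h0 := (Finset.sum_eq_zero_iff_of_nonneg
    fun j _ => log_div_add_div_sub_one_nonneg (hx j) (hy j)).1 (le_antisymm h (isDist_nonneg hx hy))
  ext j
  exact eq_of_log_div_add_div_sub_one_eq_zero (hx j) (hy j) (h0 j (Finset.mem_univ j))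

/-- The barycentric identity of the Itakura-Saito distance: when `1 / z` is the weighted mean of
the `1 / c_i`, the weighted mean of the distances to the `c_i` splits off `D(x, z)`. -/
theorem sum_mul_isDist_eq {ι : Type*} [Fintype ι] {w : ι → ℝ} {c : ι → EuclideanSpace ℝ (Fin J)}
    {x z : EuclideanSpace ℝ (Fin J)} (hx : x ∈ posOrthant J) (hz : z ∈ posOrthant J)
    (hc : ∀ i, c i ∈ posOrthant J) (hw1 : ∑ i, w i = 1)
    (hwz : ∀ j, ∑ i, w i / c i j = 1 / z j) :
    ∑ i, w i * isDist x (c i) = ∑ i, w i * isDist z (c i) + isDist x z := by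
  have key : ∀ i, w i * isDist x (c i) - w i * isDist z (c i) =
      ∑ j, (w i * Real.log (z j / x j) + (x j - z j) * (w i / c i j)) := by
    intro i
    rw [← mul_sub, isDist, isDist, ← Finset.sum_sub_distrib, Finset.mul_sum]
    refine Finset.sum_congr rfl fun j _ => ?_
    rw [Real.log_div (hc i j).ne' (hx j).ne', Real.log_div (hc i j).ne' (hz j).ne',
      Real.log_div (hz j).ne' (hx j).ne']
    ring
  have h2 : ∑ i, (w i * isDist x (c i) - w i * isDist z (c i)) = isDist x z := by
    simp_rw [key]
    rw [Finset.sum_comm, isDist]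
    refine Finset.sum_congr rfl fun j _ => ?_
    rw [Finset.sum_add_distrib, ← Finset.sum_mul, ← Finset.mul_sum, hw1, hwz j]
    have := (hz j).ne'
    field_simp
    ring
  rw [Finset.sum_sub_distrib] at h2
  linarith

/-- A point `z` is the Chebyshev center of `C` as soon as `1 / z` is a coordinatewise weighted mean
of the inverses of points of `C` that are farthest from `z`. -/
theorem isChebyshevCenter_of_weights {ι : Type*} [Fintype ι] {C : Set (EuclideanSpace ℝ (Fin J))}
    {z : EuclideanSpace ℝ (Fin J)} (hz : z ∈ posOrthant J) {m : ℝ}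
    (hm : farDist (itakuraSaito J) C z = m) {w : ι → ℝ} {c : ι → EuclideanSpace ℝ (Fin J)}
    (hc : ∀ i, c i ∈ posOrthant J) (hcC : ∀ i, c i ∈ C) (hcm : ∀ i, isDist z (c i) = m)
    (hw : ∀ i, 0 ≤ w i) (hw1 : ∑ i, w i = 1) (hwz : ∀ j, ∑ i, w i / c i j = 1 / z j) :
    IsChebyshevCenter (negLog J) (itakuraSaito J) C z := by
  have le_far : ∀ x i, itakuraSaito J x (c i) ≤ farDist (itakuraSaito J) C x :=
    fun x i => le_iSup₂_of_le (c i) (hcC i) le_rfl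
  have lower : ∀ x ∈ posOrthant J,
      ((m + isDist x z : ℝ) : EReal) ≤ farDist (itakuraSaito J) C x := by
    intro x hx
    -- The weighted mean of the distances to the `c i` is at most the largest of them.
    have hex : ∃ i, m + isDist x z ≤ isDist x (c i) := by
      by_contra! hlt
      have hid := sum_mul_isDist_eq hx hz hc hw1 hwz
      simp_rw [hcm] at hid
      rw [← Finset.sum_mul, hw1, one_mul] at hid
      have hne : ∃ i ∈ Finset.univ, 0 < w i := by
        by_contra! h
        have := Finset.sum_nonpos h
        linarith
      obtain ⟨i, hi, hpos⟩ := hne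
      have hsum : ∑ i, w i * isDist x (c i) < ∑ i, w i * (m + isDist x z) :=
        Finset.sum_lt_sum (fun k _ => mul_le_mul_of_nonneg_left (hlt k).le (hw k))
          ⟨i, hi, mul_lt_mul_of_pos_left (hlt i) hpos⟩
      rw [← Finset.sum_mul, hw1] at hsum
      linarith
    obtain ⟨i, hi⟩ := hex
    refine le_trans ?_ (le_far x i)
    rw [itakuraSaito_eq_isDist hx (hc i)]
    exact_mod_cast hi
  have hι : Nonempty ι := by
    by_contra h
    rw [not_nonempty_iff] at h
    simp at hw1
  have far_top : ∀ x ∉ posOrthant J, farDist (itakuraSaito J) C x = ⊤ := by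
    intro x hx
    have h := le_far x hι.some
    rwa [itakuraSaito_eq_top hx, top_le_iff] at h
  refine ⟨mem_effDom_negLog hz, fun x => ?_, fun z' hz' => ?_⟩
  · by_cases hx : x ∈ posOrthant J
    · refine le_trans ?_ (lower x hx)
      rw [hm]
      exact_mod_cast le_add_of_nonneg_right (isDist_nonneg hx hz)
    · rw [far_top x hx]
      exact le_top
  · have h1 := hz' z
    rw [hm] at h1
    have hpos : z' ∈ posOrthant J := by
      by_contra hn
      rw [far_top z' hn, top_le_iff] at h1
      exact EReal.coe_ne_top m h1
    have h2 := (lower z' hpos).trans h1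
    have h3 : m + isDist z' z ≤ m := by exact_mod_cast h2
    exact eq_of_isDist_le_zero hpos hz (by linarith)

/-- The farthest-distance function and the farthest points, read off from the real-valued
expression of the distance. -/
theorem farDist_eq_and_farPoints_eq {C : Set (EuclideanSpace ℝ (Fin J))}
    (hC : C ⊆ posOrthant J) {z c₀ : EuclideanSpace ℝ (Fin J)} (hz : z ∈ posOrthant J)
    (hc₀ : c₀ ∈ C) (hmax : ∀ c ∈ C, isDist z c ≤ isDist z c₀) :
    farDist (itakuraSaito J) C z = (isDist z c₀ : ℝ) ∧
      farPoints (negLog J) (itakuraSaito J) C z = {c ∈ C | isDist z c = isDist z c₀} := by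
  have hF : farDist (itakuraSaito J) C z = (isDist z c₀ : ℝ) := by
    refine le_antisymm (iSup₂_le fun c hc => ?_) ?_
    · rw [itakuraSaito_eq_isDist hz (hC hc)]
      exact_mod_cast hmax c hc
    · rw [← itakuraSaito_eq_isDist hz (hC hc₀)]
      exact le_iSup₂_of_le c₀ hc₀ le_rfl
  refine ⟨hF, ?_⟩
  rw [farPoints, if_pos (mem_effDom_negLog hz), hF]
  ext c
  refine and_congr_right fun hc => ?_
  rw [itakuraSaito_eq_isDist hz (hC hc), EReal.coe_eq_coe_iff]

/-! ### The function `p ↦ log p + k / p` -/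

/-- Strict quasiconvexity of `p ↦ log p + k / p`. -/
theorem log_add_div_lt_max {p₀ p p₁ : ℝ} (k : ℝ) (h0 : 0 < p₀) (h0p : p₀ < p) (hp1 : p < p₁) :
    Real.log p + k / p < max (Real.log p₀ + k / p₀) (Real.log p₁ + k / p₁) := by
  have hp : 0 < p := h0.trans h0p
  have h1 : 0 < p₁ := hp.trans hp1
  rw [lt_max_iff]
  rcases le_total p k with hk | hk
  · left
    have hlog := Real.log_lt_sub_one_of_pos (div_pos hp h0)
      (fun h => h0p.ne' ((div_eq_one_iff_eq h0.ne').1 h))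
    rw [Real.log_div hp.ne' h0.ne'] at hlog
    have hle : p / p₀ - 1 ≤ k / p₀ - k / p := by
      have : k / p₀ - k / p - (p / p₀ - 1) = (k - p) * (p - p₀) / (p * p₀) := by
        field_simp
      have : 0 ≤ (k - p) * (p - p₀) / (p * p₀) :=
        div_nonneg (mul_nonneg (by linarith) (by linarith)) (by positivity)
      linarith
    linarith
  · right
    have hlog := Real.log_lt_sub_one_of_pos (div_pos hp h1)
      (fun h => hp1.ne ((div_eq_one_iff_eq h1.ne').1 h))
    rw [Real.log_div hp.ne' h1.ne'] at hlog
    have hle : p / p₁ - 1 ≤ k / p₁ - k / p := by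
      have : k / p₁ - k / p - (p / p₁ - 1) = (p - k) * (p₁ - p) / (p * p₁) := by
        field_simp
        ring
      have : 0 ≤ (p - k) * (p₁ - p) / (p * p₁) :=
        div_nonneg (mul_nonneg (by linarith) (by linarith)) (by positivity)
      linarith
    linarith

/-! ### The segment and the distance from a diagonal point -/

@[simp]
theorem linePoint_apply_zero (a s : ℝ) : linePoint a s 0 = 1 + s * (a - 1) := by
  simp [linePoint]
  ring

@[simp]
theorem linePoint_apply_one (a s : ℝ) : linePoint a s 1 = a - s * (a - 1) := by
  simp [linePoint]
  ring

theorem mem_segC_iff {a : ℝ} {c : EuclideanSpace ℝ (Fin 2)} :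
    c ∈ segC a ↔ ∃ s ∈ Set.Icc (0 : ℝ) 1, linePoint a s = c := by
  rw [segC, convexHull_pair, segment_eq_image]
  rfl

theorem linePoint_mem_segC (a : ℝ) {s : ℝ} (h0 : 0 ≤ s) (h1 : s ≤ 1) : linePoint a s ∈ segC a :=
  mem_segC_iff.2 ⟨s, ⟨h0, h1⟩, rfl⟩

theorem segC_subset_posOrthant {a : ℝ} (ha : 1 < a) : segC a ⊆ posOrthant 2 := by
  intro c hc
  obtain ⟨s, ⟨h0, h1⟩, rfl⟩ := mem_segC_iff.1 hc
  refine Fin.forall_fin_two.2 ⟨?_, ?_⟩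
  · rw [linePoint_apply_zero]
    nlinarith
  · rw [linePoint_apply_one]
    nlinarith

theorem diag_mem_posOrthant {t : ℝ} (ht : 0 < t) : !₂[t, t] ∈ posOrthant 2 :=
  Fin.forall_fin_two.2 ⟨by simpa using ht, by simpa using ht⟩

/-- The product of the two coordinates of `linePoint a s`. -/
def coordProd (a s : ℝ) : ℝ :=
  a + s * (1 - s) * (a - 1) ^ 2

theorem coordProd_half (a : ℝ) : coordProd a (1 / 2) = (a + 1) ^ 2 / 4 := by
  rw [coordProd]
  ring

/-- Since the coordinates of `linePoint a s` sum to `a + 1`, its distance from a diagonal point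
depends on `s` only through their product. -/
theorem isDist_diag_linePoint {a t s : ℝ} (ha : 1 < a) (ht : 0 < t) (h0 : 0 ≤ s) (h1 : s ≤ 1) :
    isDist !₂[t, t] (linePoint a s) =
      Real.log (coordProd a s) + t * (a + 1) / coordProd a s - 2 * Real.log t - 2 := by
  have hpos := segC_subset_posOrthant ha (linePoint_mem_segC a h0 h1)
  have hu : 0 < 1 + s * (a - 1) := by simpa using hpos 0
  have hv : 0 < a - s * (a - 1) := by simpa using hpos 1
  have hp : coordProd a s = (1 + s * (a - 1)) * (a - s * (a - 1)) := by
    rw [coordProd]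
    ring
  simp only [isDist, Fin.sum_univ_two, linePoint_apply_zero, linePoint_apply_one]
  simp only [Matrix.cons_val_zero, Matrix.cons_val_one]
  rw [hp, Real.log_mul hu.ne' hv.ne', Real.log_div hu.ne' ht.ne', Real.log_div hv.ne' ht.ne']
  field_simp
  ring

theorem isDist_diag_endpoint {a t : ℝ} (ha : 1 < a) (ht : 0 < t) :
    isDist !₂[t, t] (linePoint a 1) = isDist !₂[t, t] (linePoint a 0) := by
  rw [isDist_diag_linePoint ha ht zero_le_one le_rfl,
    isDist_diag_linePoint ha ht le_rfl zero_le_one]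
  simp [coordProd]

/-- The midpoint of the segment is farther from `(t, t)` than the endpoints exactly when
`t < gVal a`. -/
theorem isDist_diag_mid_sub {a t : ℝ} (ha : 1 < a) (ht : 0 < t) :
    isDist !₂[t, t] (linePoint a (1 / 2)) - isDist !₂[t, t] (linePoint a 0) =
      (gVal a - t) * ((a - 1) ^ 2 / (a * (a + 1))) := by
  have h1 : a - 1 ≠ 0 := by linarith
  have h2 : 0 < a := by linarith
  rw [isDist_diag_linePoint ha ht (by norm_num) (by norm_num),
    isDist_diag_linePoint ha ht le_rfl zero_le_one, coordProd_half, gVal,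
    ← div_div ((a + 1) ^ 2) 4 a, Real.log_div (by positivity) h2.ne']
  simp only [coordProd, zero_mul, add_zero]
  field_simp
  ring

/-- Away from the endpoints and the midpoint, the distance from a diagonal point stays strictly
below the larger of the values there. -/
theorem isDist_diag_lt_max {a t s : ℝ} (ha : 1 < a) (ht : 0 < t) (h0 : 0 < s) (h1 : s < 1)
    (hs : s ≠ 1 / 2) :
    isDist !₂[t, t] (linePoint a s) <
      max (isDist !₂[t, t] (linePoint a 0)) (isDist !₂[t, t] (linePoint a (1 / 2))) := by
  have ha1 : 0 < (a - 1) ^ 2 := pow_pos (by linarith) 2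
  have hlow : coordProd a 0 < coordProd a s := by
    have : 0 < s * (1 - s) * (a - 1) ^ 2 := mul_pos (mul_pos h0 (by linarith)) ha1
    simp only [coordProd]
    linarith
  have hhigh : coordProd a s < coordProd a (1 / 2) := by
    have : 0 < (s - 1 / 2) ^ 2 * (a - 1) ^ 2 := mul_pos (sq_pos_of_ne_zero (sub_ne_zero.2 hs)) ha1
    simp only [coordProd]
    linarith
  have h := log_add_div_lt_max (t * (a + 1)) (by simp [coordProd]; linarith) hlow hhigh
  rw [isDist_diag_linePoint ha ht h0.le h1.le, isDist_diag_linePoint ha ht le_rfl zero_le_one,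
    isDist_diag_linePoint ha ht (by norm_num) (by norm_num)]
  rw [lt_max_iff] at h ⊢
  rcases h with h | h
  · exact Or.inl (by linarith)
  · exact Or.inr (by linarith)

/-! ### The farthest points of diagonal points -/

/-- At or beyond `gVal a` on the diagonal, the endpoints of the segment are farthest. -/
theorem isDist_diag_le {a t : ℝ} (ha : 1 < a) (ht : 0 < t) (hg : gVal a ≤ t)
    {c : EuclideanSpace ℝ (Fin 2)} (hc : c ∈ segC a) :
    isDist !₂[t, t] c ≤ isDist !₂[t, t] (linePoint a 0) := by
  have hmid : isDist !₂[t, t] (linePoint a (1 / 2)) ≤ isDist !₂[t, t] (linePoint a 0) := by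
    have hfac : 0 ≤ (a - 1) ^ 2 / (a * (a + 1)) := by positivity
    have := isDist_diag_mid_sub ha ht
    have := mul_nonneg (sub_nonneg.2 hg) hfac
    linarith
  obtain ⟨s, ⟨h0, h1⟩, rfl⟩ := mem_segC_iff.1 hc
  rcases h0.eq_or_lt with rfl | h0
  · exact le_rfl
  rcases h1.eq_or_lt with rfl | h1
  · exact (isDist_diag_endpoint ha ht).le
  by_cases hs : s = 1 / 2
  · rw [hs]
    exact hmid
  · exact (isDist_diag_lt_max ha ht h0 h1 hs).le.trans (max_le le_rfl hmid)

theorem setOf_isDist_diag_eq_of_lt {a t : ℝ} (ha : 1 < a) (ht : 0 < t) (hg : gVal a < t) :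
    {c ∈ segC a | isDist !₂[t, t] c = isDist !₂[t, t] (linePoint a 0)} =
      {linePoint a 0, linePoint a 1} := by
  have hmid : isDist !₂[t, t] (linePoint a (1 / 2)) < isDist !₂[t, t] (linePoint a 0) := by
    have hfac : 0 < (a - 1) ^ 2 / (a * (a + 1)) :=
      div_pos (pow_pos (by linarith) 2) (by positivity)
    have := isDist_diag_mid_sub ha ht
    have := mul_pos (sub_pos.2 hg) hfac
    linarith
  ext c
  constructor
  · rintro ⟨hc, hcm⟩
    obtain ⟨s, ⟨h0, h1⟩, rfl⟩ := mem_segC_iff.1 hc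
    rcases h0.eq_or_lt with rfl | h0
    · exact Or.inl rfl
    rcases h1.eq_or_lt with rfl | h1
    · exact Or.inr rfl
    by_cases hs : s = 1 / 2
    · rw [hs] at hcm
      exact absurd hcm hmid.ne
    · have h := isDist_diag_lt_max ha ht h0 h1 hs
      rw [max_eq_left hmid.le] at h
      exact absurd hcm h.ne
  · rintro (rfl | rfl)
    · exact ⟨linePoint_mem_segC a le_rfl zero_le_one, rfl⟩
    · exact ⟨linePoint_mem_segC a zero_le_one le_rfl, isDist_diag_endpoint ha ht⟩

theorem isDist_diag_gVal_mid {a : ℝ} (ha : 1 < a) (hg : 0 < gVal a) :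
    isDist !₂[gVal a, gVal a] (linePoint a (1 / 2)) =
      isDist !₂[gVal a, gVal a] (linePoint a 0) := by
  have := isDist_diag_mid_sub ha hg
  rw [sub_self, zero_mul] at this
  linarith

theorem setOf_isDist_diag_gVal_eq {a : ℝ} (ha : 1 < a) (hg : 0 < gVal a) :
    {c ∈ segC a | isDist !₂[gVal a, gVal a] c = isDist !₂[gVal a, gVal a] (linePoint a 0)} =
      {linePoint a 0, linePoint a (1 / 2), linePoint a 1} := by
  have hmid := isDist_diag_gVal_mid ha hg
  ext c
  constructor
  · rintro ⟨hc, hcm⟩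
    obtain ⟨s, ⟨h0, h1⟩, rfl⟩ := mem_segC_iff.1 hc
    rcases h0.eq_or_lt with rfl | h0
    · exact Or.inl rfl
    rcases h1.eq_or_lt with rfl | h1
    · exact Or.inr (Or.inr rfl)
    by_cases hs : s = 1 / 2
    · exact Or.inr (Or.inl (by rw [hs]))
    · have h := isDist_diag_lt_max ha hg h0 h1 hs
      rw [hmid, max_self] at h
      exact absurd hcm h.ne
  · rintro (rfl | rfl | rfl)
    · exact ⟨linePoint_mem_segC a le_rfl zero_le_one, rfl⟩
    · exact ⟨linePoint_mem_segC a (by norm_num) (by norm_num), hmid⟩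
    · exact ⟨linePoint_mem_segC a zero_le_one le_rfl, isDist_diag_endpoint ha hg⟩

/-! ### The centers -/

theorem hVal_pos {a : ℝ} (ha : 1 < a) : 0 < hVal a := by
  rw [hVal]
  positivity

theorem gVal_le {a : ℝ} (ha : 1 < a) : gVal a ≤ (a + 1) / 2 := by
  have h0 : 0 < a := by linarith
  have h1 : a - 1 ≠ 0 := by linarith
  have hlog := Real.log_le_sub_one_of_pos (show 0 < (a + 1) ^ 2 / (4 * a) by positivity)
  calc gVal a ≤ a * (a + 1) / (a - 1) ^ 2 * ((a + 1) ^ 2 / (4 * a) - 1) :=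
        mul_le_mul_of_nonneg_left hlog (by positivity)
    _ = (a + 1) / 4 := by
        field_simp
        ring
    _ ≤ (a + 1) / 2 := by linarith

theorem isChebyshevCenter_hVal {a : ℝ} (ha : 1 < a) (hgh : gVal a < hVal a) :
    IsChebyshevCenter (negLog 2) (itakuraSaito 2) (segC a) !₂[hVal a, hVal a] := by
  have ht := hVal_pos ha
  have hC := segC_subset_posOrthant ha
  have h0C : linePoint a 0 ∈ segC a := linePoint_mem_segC a le_rfl zero_le_one
  have h1C : linePoint a 1 ∈ segC a := linePoint_mem_segC a zero_le_one le_rfl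
  have hcC : ∀ i, ![linePoint a 0, linePoint a 1] i ∈ segC a := Fin.forall_fin_two.2 ⟨h0C, h1C⟩
  refine isChebyshevCenter_of_weights (diag_mem_posOrthant ht)
    (farDist_eq_and_farPoints_eq hC (diag_mem_posOrthant ht) h0C
      fun c hc => isDist_diag_le ha ht hgh.le hc).1
    (w := ![1 / 2, 1 / 2]) (c := ![linePoint a 0, linePoint a 1])
    (fun i => hC (hcC i)) hcC (Fin.forall_fin_two.2 ⟨rfl, isDist_diag_endpoint ha ht⟩)
    (Fin.forall_fin_two.2 ⟨by simp, by simp⟩) (by simp [Fin.sum_univ_two]; norm_num)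
    (Fin.forall_fin_two.2 ⟨?_, ?_⟩)
  · simp [Fin.sum_univ_two, hVal]
    field_simp
  · simp [Fin.sum_univ_two, hVal]
    field_simp
    ring

/-- If `1 / t` lies between `2 / (a + 1)` and `1 / hVal a`, it is a convex combination of them. -/
theorem exists_weight {a t : ℝ} (ha : 1 < a) (ht : hVal a ≤ t) (ht' : t ≤ (a + 1) / 2) :
    ∃ μ : ℝ, 0 ≤ μ ∧ μ ≤ 1 ∧ μ * ((a + 1) / (2 * a)) + (1 - μ) * (2 / (a + 1)) = 1 / t := by
  have ht0 : 0 < t := (hVal_pos ha).trans_le ht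
  have h1 : 1 / t ≤ (a + 1) / (2 * a) := by
    have := one_div_le_one_div_of_le (hVal_pos ha) ht
    rwa [hVal, one_div_div] at this
  have h2 : 2 / (a + 1) ≤ 1 / t := by
    have := one_div_le_one_div_of_le ht0 ht'
    rwa [one_div_div] at this
  obtain ⟨u, v, hu, hv, huv, h⟩ := (Icc_subset_segment (𝕜 := ℝ)) ⟨h2, h1⟩
  refine ⟨v, hv, by linarith, ?_⟩
  rw [← h, ← huv]
  simp only [smul_eq_mul]
  ring

theorem isChebyshevCenter_gVal {a : ℝ} (ha : 1 < a) (hgh : hVal a ≤ gVal a) :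
    IsChebyshevCenter (negLog 2) (itakuraSaito 2) (segC a) !₂[gVal a, gVal a] := by
  have ht := (hVal_pos ha).trans_le hgh
  have hC := segC_subset_posOrthant ha
  have h0C : linePoint a 0 ∈ segC a := linePoint_mem_segC a le_rfl zero_le_one
  have h1C : linePoint a 1 ∈ segC a := linePoint_mem_segC a zero_le_one le_rfl
  have hmC : linePoint a (1 / 2) ∈ segC a := linePoint_mem_segC a (by norm_num) (by norm_num)
  obtain ⟨μ, hμ0, hμ1, hμ⟩ := exists_weight ha hgh (gVal_le ha)
  have hcC : ∀ i, ![linePoint a 0, linePoint a (1 / 2), linePoint a 1] i ∈ segC a := by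
    intro i
    fin_cases i
    exacts [h0C, hmC, h1C]
  refine isChebyshevCenter_of_weights (diag_mem_posOrthant ht)
    (farDist_eq_and_farPoints_eq hC (diag_mem_posOrthant ht) h0C
      fun c hc => isDist_diag_le ha ht le_rfl hc).1
    (w := ![μ / 2, 1 - μ, μ / 2]) (c := ![linePoint a 0, linePoint a (1 / 2), linePoint a 1])
    (fun i => hC (hcC i)) hcC ?_ ?_ ?_ ?_
  · intro i
    fin_cases i
    exacts [rfl, isDist_diag_gVal_mid ha ht, isDist_diag_endpoint ha ht]
  · intro i
    fin_cases i
    exacts [div_nonneg hμ0 zero_le_two, sub_nonneg.2 hμ1, div_nonneg hμ0 zero_le_two]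
  · simp only [Fin.sum_univ_three, Matrix.cons_val_zero, Matrix.cons_val_one, Matrix.cons_val]
    ring
  · have hmid : 1 + 1 / 2 * (a - 1) = (a + 1) / 2 ∧ a - 1 / 2 * (a - 1) = (a + 1) / 2 :=
      ⟨by ring, by ring⟩
    have hend : 1 + 1 * (a - 1) = a ∧ a - 1 * (a - 1) = 1 := ⟨by ring, by ring⟩
    refine Fin.forall_fin_two.2 ⟨?_, ?_⟩
    all_goals
      simp only [Fin.sum_univ_three, Matrix.cons_val_zero, Matrix.cons_val_one, Matrix.cons_val,
        linePoint_apply_zero, linePoint_apply_one, hmid, hend, zero_mul, add_zero, sub_zero]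
      rw [← hμ]
      field_simp
      ring

end BregmanCenter

end

theorem mainTheorem8 (a : ℝ) (ha : 1 < a) :
    (BregmanCenter.gVal a < BregmanCenter.hVal a →
      BregmanCenter.IsChebyshevCenter (BregmanCenter.negLog 2) (BregmanCenter.itakuraSaito 2)
          (BregmanCenter.segC a) !₂[BregmanCenter.hVal a, BregmanCenter.hVal a] ∧
        BregmanCenter.farPoints (BregmanCenter.negLog 2) (BregmanCenter.itakuraSaito 2)
            (BregmanCenter.segC a) !₂[BregmanCenter.hVal a, BregmanCenter.hVal a] =
          {BregmanCenter.linePoint a 0, BregmanCenter.linePoint a 1}) ∧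
    (BregmanCenter.hVal a ≤ BregmanCenter.gVal a →
      BregmanCenter.IsChebyshevCenter (BregmanCenter.negLog 2) (BregmanCenter.itakuraSaito 2)
          (BregmanCenter.segC a) !₂[BregmanCenter.gVal a, BregmanCenter.gVal a] ∧
        BregmanCenter.farPoints (BregmanCenter.negLog 2) (BregmanCenter.itakuraSaito 2)
            (BregmanCenter.segC a) !₂[BregmanCenter.gVal a, BregmanCenter.gVal a] =
          {BregmanCenter.linePoint a 0, BregmanCenter.linePoint a (1 / 2),
            BregmanCenter.linePoint a 1}) := by
  have hC := BregmanCenter.segC_subset_posOrthant ha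
  have h0C := BregmanCenter.linePoint_mem_segC a le_rfl zero_le_one
  constructor
  · intro hgh
    have ht := BregmanCenter.hVal_pos ha
    refine ⟨BregmanCenter.isChebyshevCenter_hVal ha hgh, ?_⟩
    rw [(BregmanCenter.farDist_eq_and_farPoints_eq hC (BregmanCenter.diag_mem_posOrthant ht) h0C
      fun c hc => BregmanCenter.isDist_diag_le ha ht hgh.le hc).2]
    exact BregmanCenter.setOf_isDist_diag_eq_of_lt ha ht hgh
  · intro hgh
    have ht := (BregmanCenter.hVal_pos ha).trans_le hgh
    refine ⟨BregmanCenter.isChebyshevCenter_gVal ha hgh, ?_⟩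
    rw [(BregmanCenter.farDist_eq_and_farPoints_eq hC (BregmanCenter.diag_mem_posOrthant ht) h0C
      fun c hc => BregmanCenter.isDist_diag_le ha ht le_rfl hc).2]
    exact BregmanCenter.setOf_isDist_diag_gVal_eq ha ht
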